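/- Let $k$ be a field, let $n\ge 2$ and $r\ge 3n+2$ be integers, and put $s=r(3n+2)+3$. Let $\mathfrak P_{nr}\subset S=k[x_1,x_2,x_3,x_4]$ be the defining ideal of the Backelin monomial curve $B_{nr}=C(s,\,s+3,\,s+3n+1,\,s+3n+2)$, i.e. the kernel of the $k$-algebra map $S\to k[t]$ with $x_1\mapsto t^{s}$, $x_2\mapsto t^{s+3}$, $x_3\mapsto t^{s+3n+1}$, $x_4\mapsto t^{s+3n+2}$. Let $\mathrm{in}_<(\mathfrak P_{nr})$ be its initial ideal for the degree reverse lexicographic order with $x_1>x_2>x_3>x_4$. The ideal $\mathfrak P_{nr}$ is not homogeneous for the standard grading; the Hilbert function of $S/\mathfrak P_{nr}$ is taken with respect to total degree, $H(S/\mathfrak P_{nr},i)=\dim_k F_i/F_{i-1}$, where $F_i$ is the image in $S/\mathfrak P_{nr}$ of the polynomials of total degree at most $i$ and $F_{-1}=0$. The Hilbert function of $S/\mathrm{in}_<(\mathfrak P_{nr})$ is the usual one, $H(S/\mathrm{in}_<(\mathfrak P_{nr}),i)=\dim_k (S/\mathrm{in}_<(\mathfrak P_{nr}))_i$. Then $$\sum_{i\ge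 0}H(S/\mathfrak P_{nr},i)\,t^i=\sum_{i\ge 0}H(S/\mathrm{in}_<(\mathfrak P_{nr}),i)\,t^i=\frac{p(t)}{(1-t)^4},$$ where the numerator is $$\begin{aligned}p(t)={}&1-nt^{r+2}-2t^{r+3}+(3n+4)t^{r+4}-(2n+2)t^{r+5}-t^{2n+3}+2t^{2n+2}-t^{2n+1}\\&+t^{n+4}+t^{n+3}-t^{n+2}-t^{n+1}-t^{4}-\sum_{i=2}^{n}\left(t^{n+2i-1}+t^{n+2i+1}-2t^{n+2i}\right).\end{aligned}$$ -/

import Mathlib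

namespace BackelinCurve

/-- The defining ideal of the monomial curve with exponents `a`: the kernel of the `k`-algebra map
`k[x_0, …, x_{m-1}] → k[t]`, `x_i ↦ t ^ a i`. -/
noncomputable def monomialCurveIdeal (k : Type*) [Field k] {m : ℕ} (a : Fin m → ℕ) :
    Ideal (MvPolynomial (Fin m) k) :=
  RingHom.ker (MvPolynomial.aeval (fun i => (Polynomial.X : Polynomial k) ^ a i) :
    MvPolynomial (Fin m) k →ₐ[k] Polynomial k)

/-- The parameter `s = r (3n + 2) + 3` of the Backelin semigroups. -/
def backelinS (n r : ℕ) : ℕ := r * (3 * n + 2) + 3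

/-- The defining ideal `𝔓_{nr}` of the Backelin curve `C(s, s+3, s+3n+1, s+3n+2)`.
The variables `x_1, x_2, x_3, x_4` are indexed by `0, 1, 2, 3 : Fin 4`. -/
noncomputable def backelinIdeal (k : Type*) [Field k] (n r : ℕ) :
    Ideal (MvPolynomial (Fin 4) k) :=
  monomialCurveIdeal k ![backelinS n r, backelinS n r + 3,
    backelinS n r + 3 * n + 1, backelinS n r + 3 * n + 2]

section HilbertFunction

variable {k : Type*} [Field k] {m : ℕ}

/-- The image in `S/I` (`S = k[x_0, …, x_{m-1}]`) of the `k`-span of the monomials whose exponent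
lies in `D`. -/
noncomputable def imageSpan (I : Ideal (MvPolynomial (Fin m) k)) (D : Set (Fin m →₀ ℕ)) :
    Submodule k (MvPolynomial (Fin m) k ⧸ I) :=
  (MvPolynomial.restrictSupport k D).map (Ideal.Quotient.mkₐ k I).toLinearMap

/-- The (standard) Hilbert function of the graded ring `S/J` for a homogeneous ideal `J`:
`i ↦ dim_k (S/J)_i`, where `(S/J)_i` is the image of the forms of degree `i`. -/
noncomputable def gradedHilbertFunction (J : Ideal (MvPolynomial (Fin m) k)) (i : ℕ) : ℕ :=
  Module.finrank k
    ((MvPolynomial.homogeneousSubmodule (Fin m) k i).map (Ideal.Quotient.mkₐ k J).toLinearMap)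

/-- The Hilbert function of `S/I` for an arbitrary ideal `I`, with respect to total degree:
`i ↦ dim_k (F_i / F_{i-1})`, where `F_i` is the image in `S/I` of the polynomials of
total degree at most `i` (and `F_{-1} = 0`). -/
noncomputable def hilbertFunction (I : Ideal (MvPolynomial (Fin m) k)) (i : ℕ) : ℕ :=
  Module.finrank k
    (imageSpan I {d | d.degree ≤ i} ⧸
      (imageSpan I {d | d.degree < i}).submoduleOf (imageSpan I {d | d.degree ≤ i}))

/-- The strict degree reverse lexicographic order on exponents, for `x_0 > x_1 > ⋯ > x_{m-1}`:
`x^d < x^e` if `|d| < |e|`, or `|d| = |e|` and `e_i < d_i` at the last index `i`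
where `d` and `e` differ. -/
def DegRevLexLT (d e : Fin m →₀ ℕ) : Prop :=
  d.degree < e.degree ∨
    (d.degree = e.degree ∧ ∃ i, e i < d i ∧ ∀ j, i < j → d j = e j)

/-- `x^d` is the leading monomial of `f` for the degree reverse lexicographic order. -/
def IsLeadingExponent (f : MvPolynomial (Fin m) k) (d : Fin m →₀ ℕ) : Prop :=
  d ∈ f.support ∧ ∀ e ∈ f.support, e ≠ d → DegRevLexLT e d

/-- The initial ideal of `I` for the degree reverse lexicographic order. -/
noncomputable def initialIdeal (I : Ideal (MvPolynomial (Fin m) k)) :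
    Ideal (MvPolynomial (Fin m) k) :=
  Ideal.span {g | ∃ f ∈ I, ∃ d, IsLeadingExponent f d ∧ g = MvPolynomial.monomial d 1}

end HilbertFunction

/-- The generating series `∑ h(i) t^i` of `h : ℕ → ℕ`, as an integer power series. -/
noncomputable def series (h : ℕ → ℕ) : PowerSeries ℤ := PowerSeries.mk fun i => (h i : ℤ)

open Polynomial in
/-- The polynomial `p(t)` in the formula for the Hilbert series of the Backelin curve. -/
noncomputable def backelinNumerator (n r : ℕ) : Polynomial ℤ :=
  1 - (n : ℤ[X]) * X ^ (r + 2) - 2 * X ^ (r + 3) + (3 * (n : ℤ[X]) + 4) * X ^ (r + 4)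
    - (2 * (n : ℤ[X]) + 2) * X ^ (r + 5)
    - X ^ (2 * n + 3) + 2 * X ^ (2 * n + 2) - X ^ (2 * n + 1)
    + X ^ (n + 4) + X ^ (n + 3) - X ^ (n + 2) - X ^ (n + 1) - X ^ 4
    - ∑ i ∈ Finset.Icc 2 n,
        (X ^ (n + 2 * i - 1) + X ^ (n + 2 * i + 1) - 2 * X ^ (n + 2 * i))

end BackelinCurve

namespace BackelinCurve

/-! The quotient by a monomial curve ideal embeds in `k[t]`, so its degree filtration just counts
weights: `H(i)` is the number of weights attained in degree `i` and in no smaller degree. Each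
attained weight has a unique degrevlex-minimal exponent, of least degree in its fibre. These minimal
exponents are the standard monomials of the initial ideal, so both Hilbert functions agree for every
monomial curve (`gradedHilbertFunction_initialIdeal`).

For the Backelin curve a weight in degree `i` is `s * i + x`, with `x` in the `i`-fold sumset of {0,
3, 3n+1, 3n+2}. Hence `H(i)` is the size of this sumset minus the number of `x` already reached in
lower degree. The sumset is counted by unique shortest normal forms (`exists_isNormalTriple`,
`eq_of_tripleValue_eq`). Large sumsets have no gaps beyond those of the semigroup
(`mem_boundedSums_iff`), which makes the loss explicit (`ncard_boundedSums_inter`). Summing the two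
series gives the numerator. -/

/-- The weight of an exponent: the degree in `t` of the image of the monomial under `x_i ↦ t ^ a i`. -/
def expWeight {m : ℕ} (a : Fin m → ℕ) (d : Fin m →₀ ℕ) : ℕ := ∑ i, a i * d i

theorem expWeight_add {m : ℕ} (a : Fin m → ℕ) (d e : Fin m →₀ ℕ) :
    expWeight a (d + e) = expWeight a d + expWeight a e := by
  simp [expWeight, mul_add, Finset.sum_add_distrib]

/-! ### Hilbert functions of monomial curves as counts of weights -/

section

variable {k : Type*} [Field k] {m : ℕ}

/-- The parametrization `x_i ↦ t ^ a i`. -/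
noncomputable abbrev curveHom (k : Type*) [Field k] (a : Fin m → ℕ) :
    MvPolynomial (Fin m) k →ₐ[k] Polynomial k :=
  MvPolynomial.aeval (fun i => (Polynomial.X : Polynomial k) ^ a i)

theorem mem_monomialCurveIdeal (a : Fin m → ℕ) (f : MvPolynomial (Fin m) k) :
    f ∈ monomialCurveIdeal k a ↔ curveHom k a f = 0 := by
  simp [monomialCurveIdeal, RingHom.mem_ker]

theorem curveHom_monomial (a : Fin m → ℕ) (d : Fin m →₀ ℕ) (c : k) :
    curveHom k a (MvPolynomial.monomial d c) = Polynomial.monomial (expWeight a d) c := by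
  rw [curveHom, MvPolynomial.aeval_monomial, Finsupp.prod_fintype _ _ (by simp)]
  simp_rw [← pow_mul]
  rw [Finset.prod_pow_eq_pow_sum, expWeight, Polynomial.algebraMap_eq, Polynomial.C_mul_X_pow_eq_monomial]

theorem finrank_span_monomial (A : Set ℕ) :
    Module.finrank k (Submodule.span k ((fun v => Polynomial.monomial v (1 : k)) '' A)) =
      A.ncard := by
  have hli : LinearIndependent k (fun v : A => Polynomial.monomial (v : ℕ) (1 : k)) := by
    have h := (Polynomial.basisMonomials k).linearIndependent
    rw [Polynomial.coe_basisMonomials] at h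
    exact h.comp (fun v : A => (v : ℕ)) Subtype.val_injective
  have h := Module.finrank_eq_nat_card_basis (Module.Basis.span hli)
  rw [show Set.range (fun v : A => Polynomial.monomial (v : ℕ) (1 : k)) =
    (fun v => Polynomial.monomial v (1 : k)) '' A by
      ext; simp] at h
  exact h

/-- The quotient injects into `k[t]`, and each monomial lands on a power of `t`; distinct powers are
independent. -/
theorem finrank_imageSpan (a : Fin m → ℕ) (D : Set (Fin m →₀ ℕ)) :
    Module.finrank k (imageSpan (monomialCurveIdeal k a) D) = (expWeight a '' D).ncard := by
  let ψ : (MvPolynomial (Fin m) k ⧸ monomialCurveIdeal k a) →ₗ[k] Polynomial k :=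
    (Ideal.kerLiftAlg (curveHom k a)).toLinearMap
  have hψ : Function.Injective ψ := Ideal.kerLiftAlg_injective (curveHom k a)
  rw [(Submodule.equivMapOfInjective ψ hψ _).finrank_eq, imageSpan, ← Submodule.map_comp,
    ← finrank_span_monomial (k := k), MvPolynomial.restrictSupport_eq_span, Submodule.map_span,
    Set.image_image, Set.image_image]
  refine congrArg (fun p : Submodule k (Polynomial k) => Module.finrank k p) ?_
  refine congrArg (Submodule.span k) (Set.image_congr fun d _ => ?_)
  exact curveHom_monomial a d 1

theorem finite_degree_le (i : ℕ) : {d : Fin m →₀ ℕ | d.degree ≤ i}.Finite :=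
  Finsupp.finite_of_degree_le i

theorem hilbertFunction_monomialCurveIdeal (a : Fin m → ℕ) (i : ℕ) :
    hilbertFunction (monomialCurveIdeal k a) i =
      (expWeight a '' {d | d.degree ≤ i} \ expWeight a '' {d | d.degree < i}).ncard := by
  have hle : imageSpan (monomialCurveIdeal k a) {d | d.degree < i} ≤
      imageSpan (monomialCurveIdeal k a) {d | d.degree ≤ i} :=
    Submodule.map_mono (MvPolynomial.restrictSupport_mono k fun d hd =>
      le_of_lt (Set.mem_ofPred_eq ▸ hd))
  have hfin : Module.Finite k (imageSpan (monomialCurveIdeal k a) {d | d.degree ≤ i}) := by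
    rw [imageSpan, MvPolynomial.restrictSupport_eq_span, Submodule.map_span]
    exact Module.Finite.span_of_finite k (((finite_degree_le i).image _).image _)
  have h := Submodule.finrank_quotient_add_finrank
    ((imageSpan (monomialCurveIdeal k a) {d | d.degree < i}).submoduleOf
      (imageSpan (monomialCurveIdeal k a) {d | d.degree ≤ i}))
  rw [(Submodule.submoduleOfEquivOfLe hle).finrank_eq, finrank_imageSpan, finrank_imageSpan] at h
  have hsub : expWeight a '' {d | d.degree < i} ⊆ expWeight a '' {d | d.degree ≤ i} :=
    Set.image_mono fun d hd => le_of_lt (Set.mem_ofPred_eq ▸ hd)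
  have h2 := Set.ncard_sdiff_add_ncard_of_subset hsub ((finite_degree_le i).image _)
  rw [hilbertFunction]
  omega

/-! ### Degree reverse lexicographic order and the initial ideal -/

theorem DegRevLexLT.trans {d e f : Fin m →₀ ℕ} (h : DegRevLexLT d e) (h' : DegRevLexLT e f) :
    DegRevLexLT d f := by
  rcases h with h | ⟨h, i, hi, hij⟩ <;> rcases h' with h' | ⟨h', i', hi', hij'⟩
  · exact Or.inl (h.trans h')
  · exact Or.inl (h' ▸ h)
  · exact Or.inl (h ▸ h')
  · refine Or.inr ⟨h.trans h', max i i', ?_, fun j hj => ?_⟩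
    · rcases lt_trichotomy i i' with hlt | rfl | hlt
      · rw [max_eq_right hlt.le, hij _ hlt]; exact hi'
      · rw [max_self]; exact hi'.trans hi
      · rw [max_eq_left hlt.le, ← hij' _ hlt]; exact hi
    · rw [hij j (lt_of_le_of_lt (le_max_left _ _) hj), hij' j (lt_of_le_of_lt (le_max_right _ _) hj)]

theorem DegRevLexLT.irrefl (d : Fin m →₀ ℕ) : ¬ DegRevLexLT d d := by
  rintro (h | ⟨_, i, hi, _⟩)
  · exact lt_irrefl _ h
  · exact lt_irrefl _ hi

theorem DegRevLexLT.ne {d e : Fin m →₀ ℕ} (h : DegRevLexLT d e) : d ≠ e := by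
  rintro rfl
  exact DegRevLexLT.irrefl d h

theorem DegRevLexLT.degree_le {d e : Fin m →₀ ℕ} (h : DegRevLexLT d e) :
    d.degree ≤ e.degree :=
  h.elim le_of_lt fun h => h.1.le

theorem degRevLexLT_total {d e : Fin m →₀ ℕ} (hne : d ≠ e) :
    DegRevLexLT d e ∨ DegRevLexLT e d := by
  rcases lt_trichotomy d.degree e.degree with h | h | h
  · exact Or.inl (Or.inl h)
  · have hs : (Finset.univ.filter fun i => d i ≠ e i).Nonempty := by
      by_contra hc
      rw [Finset.not_nonempty_iff_eq_empty, Finset.filter_eq_empty_iff] at hc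
      exact hne (Finsupp.ext fun i => by simpa using hc (Finset.mem_univ i))
    obtain ⟨i, hi, hmax⟩ := Finset.exists_max_image _ id hs
    have hij : ∀ j, i < j → d j = e j := fun j hj => by
      by_contra hc
      exact absurd (hmax j (by simpa using hc)) (not_le.mpr hj)
    have hi' : d i ≠ e i := by simpa using hi
    rcases hi'.lt_or_gt with hlt | hlt
    · exact Or.inr (Or.inr ⟨h.symm, i, hlt, fun j hj => (hij j hj).symm⟩)
    · exact Or.inl (Or.inr ⟨h, i, hlt, hij⟩)
  · exact Or.inr (Or.inl h)

theorem DegRevLexLT.add_right {d e : Fin m →₀ ℕ} (h : DegRevLexLT d e) (c : Fin m →₀ ℕ) :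
    DegRevLexLT (d + c) (e + c) := by
  rcases h with h | ⟨h, i, hi, hij⟩
  · exact Or.inl (by simpa using h)
  · exact Or.inr ⟨by simpa using h, i, by simpa using hi, fun j hj => by simpa using hij j hj⟩

/-- The exponents that are not minimal in their fibre of the weight. -/
def NonMinimal (a : Fin m → ℕ) (d : Fin m →₀ ℕ) : Prop :=
  ∃ e, expWeight a e = expWeight a d ∧ DegRevLexLT e d

theorem NonMinimal.mono {a : Fin m → ℕ} {d d' : Fin m →₀ ℕ} (h : NonMinimal a d) (hle : d ≤ d') :
    NonMinimal a d' := by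
  obtain ⟨e, he, hlt⟩ := h
  obtain ⟨c, rfl⟩ := exists_add_of_le hle
  exact ⟨e + c, by rw [expWeight_add, expWeight_add, he], hlt.add_right c⟩

/-- If `d` is minimal in its fibre and leads `f`, no other term of `f` has the same weight, so the
coefficient at `d` survives in `k[t]` and `f` is not in the ideal. Conversely, a smaller `e` of
equal weight gives the binomial x^d - x^e. -/
theorem exists_isLeadingExponent_iff (a : Fin m → ℕ) (d : Fin m →₀ ℕ) :
    (∃ f ∈ monomialCurveIdeal k a, IsLeadingExponent f d) ↔ NonMinimal a d := by
  classical
  constructor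
  · rintro ⟨f, hf, hd, hlead⟩
    rw [mem_monomialCurveIdeal] at hf
    by_contra hmin
    have hcoeff : (curveHom k a f).coeff (expWeight a d) = f.coeff d := by
      conv_lhs => rw [f.as_sum, map_sum, Polynomial.finsetSum_coeff]
      rw [Finset.sum_eq_single d]
      · rw [curveHom_monomial, Polynomial.coeff_monomial, if_pos rfl]
      · intro e he hne
        rw [curveHom_monomial, Polynomial.coeff_monomial, if_neg]
        exact fun heq => hmin ⟨e, heq, hlead e he hne⟩
      · exact fun h => absurd hd h
    rw [hf, Polynomial.coeff_zero] at hcoeff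
    exact (MvPolynomial.mem_support_iff.mp hd) hcoeff.symm
  · rintro ⟨e, he, hlt⟩
    refine ⟨MvPolynomial.monomial d 1 - MvPolynomial.monomial e 1, ?_, ?_, ?_⟩
    · rw [mem_monomialCurveIdeal, map_sub, curveHom_monomial, curveHom_monomial, he, sub_self]
    · simp [MvPolynomial.mem_support_iff, MvPolynomial.coeff_monomial, hlt.ne]
    · intro e' he' hne
      have : e' = e := by
        by_contra hc
        apply MvPolynomial.mem_support_iff.mp he'
        simp [MvPolynomial.coeff_monomial, Ne.symm hne, Ne.symm hc]
      exact this ▸ hlt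

theorem initialIdeal_monomialCurveIdeal (a : Fin m → ℕ) :
    initialIdeal (monomialCurveIdeal k a) =
      Ideal.span ((fun d => MvPolynomial.monomial d (1 : k)) '' {d | NonMinimal a d}) := by
  rw [initialIdeal]
  congr 1
  ext g
  simp only [Set.mem_ofPred_eq, Set.mem_image, ← exists_isLeadingExponent_iff (k := k)]
  constructor
  · rintro ⟨f, hf, d, hd, rfl⟩
    exact ⟨d, ⟨f, hf, hd⟩, rfl⟩
  · rintro ⟨d, ⟨f, hf, hd⟩, rfl⟩
    exact ⟨f, hf, d, hd, rfl⟩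

theorem mem_initialIdeal_iff (a : Fin m → ℕ) (f : MvPolynomial (Fin m) k) :
    f ∈ initialIdeal (monomialCurveIdeal k a) ↔ ∀ d ∈ f.support, NonMinimal a d := by
  rw [initialIdeal_monomialCurveIdeal, MvPolynomial.mem_ideal_span_monomial_image]
  exact forall₂_congr fun d _ =>
    ⟨fun ⟨e, he, hle⟩ => NonMinimal.mono he hle, fun h => ⟨d, h, le_rfl⟩⟩

theorem gradedHilbertFunction_eq_ncard (a : Fin m → ℕ) (i : ℕ) :
    gradedHilbertFunction (initialIdeal (monomialCurveIdeal k a)) i =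
      {d : Fin m →₀ ℕ | d.degree = i ∧ ¬ NonMinimal a d}.ncard := by
  set J := initialIdeal (monomialCurveIdeal k a)
  set B := {d : Fin m →₀ ℕ | d.degree = i ∧ ¬ NonMinimal a d}
  let q : MvPolynomial (Fin m) k →ₗ[k] MvPolynomial (Fin m) k ⧸ J :=
    (Ideal.Quotient.mkₐ k J).toLinearMap
  have hq : ∀ f, q f = 0 ↔ f ∈ J := fun f => Ideal.Quotient.eq_zero_iff_mem
  have himage : (MvPolynomial.homogeneousSubmodule (Fin m) k i).map q =
      (MvPolynomial.restrictSupport k B).map q := by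
    rw [MvPolynomial.homogeneousSubmodule_eq_finsupp_supported]
    change (MvPolynomial.restrictSupport k {d | d.degree = i}).map q = _
    apply le_antisymm
    · rw [MvPolynomial.restrictSupport_eq_span, Submodule.map_span, Submodule.span_le]
      rintro _ ⟨_, ⟨d, hd, rfl⟩, rfl⟩
      by_cases hmin : NonMinimal a d
      · have : q (MvPolynomial.monomial d 1) = 0 := by
          rw [hq, mem_initialIdeal_iff]
          intro e he
          have he' := MvPolynomial.support_monomial_subset he
          rw [Finset.mem_singleton] at he'
          exact he' ▸ hmin
        simp only [this, SetLike.mem_coe, zero_mem]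
      · exact Submodule.mem_map_of_mem
          ((MvPolynomial.monomial_mem_restrictSupport k).mpr (Or.inl ⟨hd, hmin⟩))
    · exact Submodule.map_mono (MvPolynomial.restrictSupport_mono k fun d hd => hd.1)
  have hinj : Function.Injective (q.domRestrict (MvPolynomial.restrictSupport k B)) := by
    rw [← LinearMap.ker_eq_bot, LinearMap.ker_eq_bot']
    rintro ⟨f, hf⟩ h0
    have h1 : f ∈ J := (hq f).mp h0
    rw [mem_initialIdeal_iff] at h1
    rw [MvPolynomial.mem_restrictSupport_iff] at hf
    ext1
    change f = 0
    rw [← MvPolynomial.support_eq_empty, Finset.eq_empty_iff_forall_notMem]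
    exact fun d hd => (hf hd).2 (h1 d hd)
  rw [gradedHilbertFunction]
  change Module.finrank k ((MvPolynomial.homogeneousSubmodule (Fin m) k i).map q) = _
  rw [himage, ← LinearMap.range_domRestrict, LinearMap.finrank_range_of_inj hinj,
    Module.finrank_eq_nat_card_basis (MvPolynomial.basisRestrictSupport k B)]
  rfl

/-- Bounding the degree keeps the search finite, even if some weights vanish. -/
theorem exists_minimal_expWeight_eq (a : Fin m → ℕ) (d : Fin m →₀ ℕ) :
    ∃ e, expWeight a e = expWeight a d ∧ e.degree ≤ d.degree ∧ ¬ NonMinimal a e := by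
  have : IsStrictOrder (Fin m →₀ ℕ) DegRevLexLT :=
    { irrefl := DegRevLexLT.irrefl, trans := fun _ _ _ => DegRevLexLT.trans }
  have hfin : {e : Fin m →₀ ℕ | expWeight a e = expWeight a d ∧ e.degree ≤ d.degree}.Finite :=
    (finite_degree_le d.degree).subset fun e he => he.2
  have hwf := hfin.wellFoundedOn (r := DegRevLexLT)
  obtain ⟨⟨e, he⟩, -, hmin⟩ := hwf.has_min Set.univ ⟨⟨d, rfl, le_rfl⟩, trivial⟩
  refine ⟨e, he.1, he.2, ?_⟩
  rintro ⟨e', he', hlt⟩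
  exact hmin ⟨e', he'.trans he.1, hlt.degree_le.trans he.2⟩ trivial hlt

theorem gradedHilbertFunction_initialIdeal (a : Fin m → ℕ) (i : ℕ) :
    gradedHilbertFunction (initialIdeal (monomialCurveIdeal k a)) i =
      hilbertFunction (monomialCurveIdeal k a) i := by
  rw [gradedHilbertFunction_eq_ncard, hilbertFunction_monomialCurveIdeal]
  refine Set.ncard_congr (fun d _ => expWeight a d) ?_ ?_ ?_
  · rintro d ⟨hd, hmin⟩
    refine ⟨⟨d, hd.le, rfl⟩, ?_⟩
    rintro ⟨e, he, hw⟩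
    exact hmin ⟨e, hw, Or.inl (hd ▸ he)⟩
  · rintro d e ⟨hd, hmin⟩ ⟨he, hmin'⟩ hw
    by_contra hne
    rcases degRevLexLT_total hne with h | h
    · exact hmin' ⟨d, hw, h⟩
    · exact hmin ⟨e, hw.symm, h⟩
  · rintro v ⟨⟨d, hd, rfl⟩, hlt⟩
    obtain ⟨e, hw, hle, hmin⟩ := exists_minimal_expWeight_eq a d
    refine ⟨e, ⟨le_antisymm (hle.trans hd) ?_, hmin⟩, hw⟩
    by_contra hc
    exact hlt ⟨e, not_le.mp hc, hw⟩

end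

/-! ### Normal forms for sums of 3, 3n+1, 3n+2 -/

/-- The element `3a + (3n+1)b + (3n+2)c` of the semigroup generated by `3`, `3n+1`, `3n+2`. -/
def tripleValue (n a b c : ℕ) : ℕ := 3 * a + (3 * n + 1) * b + (3 * n + 2) * c

/-- The `i`-fold sumset of `{0, 3, 3n+1, 3n+2}`. -/
def boundedSums (n i : ℕ) : Set ℕ := {x | ∃ a b c, a + b + c ≤ i ∧ tripleValue n a b c = x}

/-- The triples that are the preferred shortest representations of their value. -/
def IsNormalTriple (n a b c : ℕ) : Prop :=
  (a = 0 ∧ b ≤ 3 * n + 1) ∨ (1 ≤ a ∧ a ≤ n ∧ b ≤ 2 ∧ c + 3 * a ≤ 3 * n) ∨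
    (n < a ∧ a ≤ 2 * n ∧ b = 0 ∧ c = 0)

/-- With B = 3n+1 and C = 3n+2, the moves are (3n+2)B = (3n+1)C, 3 + 3B = 3C, a·3 + (3j+1)C =
(3j+2)B for a + j = n, (2n+1)·3 = B + C, (n+1)·3 + B = 2C and n·3 + C = 2B. Some preserve length but
remove threes, so the decreasing measure counts `a` twice. -/
theorem exists_reduction {n a b c : ℕ} (hn : 2 ≤ n) (h : ¬ IsNormalTriple n a b c) :
    ∃ a' b' c', tripleValue n a' b' c' = tripleValue n a b c ∧ a' + b' + c' ≤ a + b + c ∧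
      a' + b' + c' + a' < a + b + c + a := by
  unfold IsNormalTriple at h
  unfold tripleValue
  rcases Nat.eq_zero_or_pos a with rfl | ha
  · obtain ⟨b, rfl⟩ := Nat.exists_eq_add_of_le (show 3 * n + 2 ≤ b by omega)
    exact ⟨0, b, c + (3 * n + 1), by ring, by omega, by omega⟩
  obtain hb | hb := Nat.lt_or_ge 2 b
  · obtain ⟨b, rfl⟩ := Nat.exists_eq_add_of_le (show 3 ≤ b by omega)
    obtain ⟨a, rfl⟩ := Nat.exists_eq_add_of_le (show 1 ≤ a by omega)
    exact ⟨a, b, c + 3, by ring, by omega, by omega⟩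
  obtain han | han := Nat.le_total a n
  · obtain ⟨j, rfl⟩ := Nat.exists_eq_add_of_le han
    obtain ⟨c, rfl⟩ := Nat.exists_eq_add_of_le (show 3 * j + 1 ≤ c by omega)
    exact ⟨0, b + (3 * j + 2), c, by ring, by omega, by omega⟩
  obtain ⟨a, rfl⟩ := Nat.exists_eq_add_of_le han
  obtain hc | hc := Nat.eq_zero_or_pos c
  · obtain ⟨a, rfl⟩ := Nat.exists_eq_add_of_le (show 1 ≤ a by omega)
    obtain hb | hb := Nat.eq_zero_or_pos b
    · obtain ⟨a, rfl⟩ := Nat.exists_eq_add_of_le (show n ≤ a by omega)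
      exact ⟨a, b + 1, c + 1, by ring, by omega, by omega⟩
    · obtain ⟨b, rfl⟩ := Nat.exists_eq_add_of_le (show 1 ≤ b by omega)
      exact ⟨a, b, c + 2, by ring, by omega, by omega⟩
  · obtain ⟨c, rfl⟩ := Nat.exists_eq_add_of_le (show 1 ≤ c by omega)
    exact ⟨a, b + 2, c, by ring, by omega, by omega⟩

theorem exists_isNormalTriple {n : ℕ} (hn : 2 ≤ n) (a b c : ℕ) :
    ∃ a' b' c', tripleValue n a' b' c' = tripleValue n a b c ∧ a' + b' + c' ≤ a + b + c ∧
      IsNormalTriple n a' b' c' := by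
  by_cases h : IsNormalTriple n a b c
  · exact ⟨a, b, c, rfl, le_rfl, h⟩
  · obtain ⟨a₁, b₁, c₁, hv, hle, hlt⟩ := exists_reduction hn h
    obtain ⟨a₂, b₂, c₂, hv', hle', h'⟩ := exists_isNormalTriple hn a₁ b₁ c₁
    exact ⟨a₂, b₂, c₂, hv'.trans hv, hle'.trans hle, h'⟩
termination_by a + b + c + a

/-- The value is (3n+2)(b+c) - b, so `b` is determined modulo 3n+2. -/
theorem eq_of_tripleValue_eq_of_eq_zero {n b c b' c' : ℕ} (hb : b ≤ 3 * n + 1)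
    (hb' : b' ≤ 3 * n + 1) (h : tripleValue n 0 b c = tripleValue n 0 b' c') :
    b = b' ∧ c = c' := by
  unfold tripleValue at h
  have h1 : ((3 * n + 2) * (b + c) : ℤ) - b = (3 * n + 2) * (b' + c') - b' := by
    zify at h; linarith
  have h2 : (b : ℤ) - b' = (3 * n + 2) * ((b + c) - (b' + c')) := by linarith
  have h3 : ((b : ℤ) + c) - (b' + c') = 0 := by
    by_contra hne
    rcases lt_or_gt_of_ne hne with hlt | hlt
    · nlinarith
    · nlinarith
  rw [h3, mul_zero] at h2
  omega

theorem tripleValue_ne_of_pos {n b c a' b' c' : ℕ} (ha' : 1 ≤ a')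
    (h' : IsNormalTriple n a' b' c') : tripleValue n 0 b c ≠ tripleValue n a' b' c' := by
  intro h
  obtain ⟨u, hu⟩ : ∃ u : ℤ, u = b - b' := ⟨_, rfl⟩
  obtain ⟨w, hw⟩ : ∃ w : ℤ, w = c - c' := ⟨_, rfl⟩
  have hkey : (3 * n + 1) * u + (3 * n + 2) * w = 3 * (a' : ℤ) := by
    unfold tripleValue at h
    zify at h
    rw [hu, hw]
    linarith
  -- Here 3a' ≤ 6n leaves only the values 0, 3n+1, 3n+2, none of which is a positive multiple of 3.
  have hbound : 0 ≤ u → 0 ≤ w → False := by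
    intro hu0 hw0
    have ha2 : a' ≤ 2 * n := by unfold IsNormalTriple at h'; omega
    have hsum : u + w < 2 := by
      by_contra hc
      nlinarith
    obtain rfl | rfl : u = 0 ∨ u = 1 := by omega
    · obtain rfl | rfl : w = 0 ∨ w = 1 := by omega
      all_goals omega
    · obtain rfl : w = 0 := by omega
      omega
  rcases h' with h' | ⟨-, han, hb', hc'⟩ | h'
  · omega
  · rcases lt_or_ge w 0 with hw0 | hw0
    -- The right side is positive and at most 3a' + c' ≤ 3n, hence not a multiple of 3n+1.
    · have h1 : (3 * n + 1) * (u + w) = 3 * (a' : ℤ) - w := by linarith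
      have h2 : 0 < u + w := by
        by_contra hc
        nlinarith
      nlinarith
    · rcases lt_or_ge u 0 with hu0 | hu0
      · have hu2 : -2 ≤ u := by omega
        have hw3 : w < 3 := by
          by_contra hc
          nlinarith
        interval_cases u <;> interval_cases w <;> omega
      · exact hbound hu0 hw0
  · exact hbound (by omega) (by omega)

theorem eq_of_tripleValue_eq_of_le {n a b c a' b' c' : ℕ} (ha : 1 ≤ a) (ha' : 1 ≤ a')
    (h : IsNormalTriple n a b c) (h' : IsNormalTriple n a' b' c')
    (hv : tripleValue n a b c = tripleValue n a' b' c') (hc : c' ≤ c) :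
    a = a' ∧ b = b' ∧ c = c' := by
  obtain ⟨u, hu⟩ : ∃ u : ℤ, u = b' - b := ⟨_, rfl⟩
  obtain ⟨w, rfl⟩ := Nat.exists_eq_add_of_le hc
  have hkey : (3 * n + 2) * (w : ℤ) = 3 * (a' - a) + (3 * n + 1) * u := by
    unfold tripleValue at hv
    zify at hv
    rw [hu]
    linarith
  unfold IsNormalTriple at h h'
  have hu2 : u ≤ 2 := by omega
  have hu2' : -2 ≤ u := by omega
  have hw3 : w < 3 := by
    by_contra hw
    have h1 : (3 * n + 2) * 3 ≤ (3 * n + 2) * (w : ℤ) :=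
      mul_le_mul_of_nonneg_left (by omega) (by omega)
    rw [hkey] at h1
    interval_cases u <;> omega
  interval_cases u <;> interval_cases w <;> omega

theorem eq_of_tripleValue_eq {n a b c a' b' c' : ℕ} (h : IsNormalTriple n a b c)
    (h' : IsNormalTriple n a' b' c') (hv : tripleValue n a b c = tripleValue n a' b' c') :
    a = a' ∧ b = b' ∧ c = c' := by
  rcases Nat.eq_zero_or_pos a with rfl | ha <;> rcases Nat.eq_zero_or_pos a' with rfl | ha'
  · unfold IsNormalTriple at h h'
    exact ⟨rfl, eq_of_tripleValue_eq_of_eq_zero (by omega) (by omega) hv⟩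
  · exact absurd hv (tripleValue_ne_of_pos ha' h')
  · exact absurd hv.symm (tripleValue_ne_of_pos ha h)
  · rcases Nat.le_total c' c with hc | hc
    · exact eq_of_tripleValue_eq_of_le ha ha' h h' hv hc
    · obtain ⟨h1, h2, h3⟩ := eq_of_tripleValue_eq_of_le ha' ha h' h hv.symm hc
      exact ⟨h1.symm, h2.symm, h3.symm⟩

/-- Normal triples with a ≥ 1 have length at most 3n. One with a = 0 and length L has value above
(3n+2)(L-1), so the size bound forces L ≤ i. -/
theorem mem_boundedSums_iff {n i x : ℕ} (hn : 2 ≤ n) (hi : 3 * n ≤ i) :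
    x ∈ boundedSums n i ↔ x ≤ (3 * n + 2) * i ∧ (3 ∣ x ∨ 3 * n + 1 ≤ x) := by
  constructor
  · rintro ⟨a, b, c, hle, rfl⟩
    unfold tripleValue
    refine ⟨by nlinarith, ?_⟩
    by_cases hbc : b + c = 0
    · left
      obtain ⟨rfl, rfl⟩ : b = 0 ∧ c = 0 := by omega
      simp
    · right
      nlinarith [show 1 ≤ b + c by omega]
  · rintro ⟨hle, hx⟩
    obtain ⟨a, b, c, rfl⟩ : ∃ a b c, tripleValue n a b c = x := by
      unfold tripleValue
      by_cases h0 : 3 ∣ x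
      · exact ⟨x / 3, 0, 0, by omega⟩
      · by_cases h1 : x % 3 = 1
        · exact ⟨(x - (3 * n + 1)) / 3, 1, 0, by omega⟩
        · exact ⟨(x - (3 * n + 2)) / 3, 0, 1, by omega⟩
    obtain ⟨a', b', c', hv, -, hnorm⟩ := exists_isNormalTriple hn a b c
    refine ⟨a', b', c', ?_, hv⟩
    rw [← hv] at hle
    unfold tripleValue at hle
    rcases hnorm with ⟨rfl, hb⟩ | h | h
    · by_contra hc
      nlinarith
    · omega
    · omega

/-! ### Weights of the Backelin curve and the loss to lower degrees -/

/-- The exponents of the parametrization of the Backelin curve. -/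
def backelinExponents (n r : ℕ) : Fin 4 → ℕ :=
  ![backelinS n r, backelinS n r + 3, backelinS n r + 3 * n + 1, backelinS n r + 3 * n + 2]

theorem expWeight_backelinExponents (n r : ℕ) (d : Fin 4 →₀ ℕ) :
    expWeight (backelinExponents n r) d =
      backelinS n r * d.degree + tripleValue n (d 1) (d 2) (d 3) := by
  rw [Finsupp.degree_eq_sum]
  simp only [expWeight, backelinExponents, tripleValue, Fin.sum_univ_four]
  simp
  ring

theorem mem_image_expWeight_iff (n r v : ℕ) (P : ℕ → Prop) :
    v ∈ expWeight (backelinExponents n r) '' {d | P d.degree} ↔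
      ∃ j, P j ∧ ∃ x ∈ boundedSums n j, backelinS n r * j + x = v := by
  constructor
  · rintro ⟨d, hd, rfl⟩
    refine ⟨d.degree, hd, _, ⟨d 1, d 2, d 3, ?_, rfl⟩,
      (expWeight_backelinExponents n r d).symm⟩
    rw [Finsupp.degree_eq_sum, Fin.sum_univ_four]
    omega
  · rintro ⟨j, hj, _, ⟨a, b, c, hle, rfl⟩, rfl⟩
    have hdeg : (Finsupp.equivFunOnFinite.symm ![j - (a + b + c), a, b, c]).degree = j := by
      rw [Finsupp.degree_eq_sum, Fin.sum_univ_four]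
      simp
      omega
    refine ⟨Finsupp.equivFunOnFinite.symm ![j - (a + b + c), a, b, c], ?_, ?_⟩
    · rw [Set.mem_ofPred_eq, hdeg]
      exact hj
    · rw [expWeight_backelinExponents, hdeg]
      simp

theorem le_of_mem_boundedSums {n i x : ℕ} (hn : 1 ≤ n) (h : x ∈ boundedSums n i) : x ≤ (3 * n + 2) * i := by
  obtain ⟨a, b, c, hle, rfl⟩ := h
  unfold tripleValue
  have h1 := Nat.mul_le_mul_left (3 * n + 2) hle
  have h2 := Nat.mul_le_mul_right a hn
  nlinarith

theorem finite_boundedSums {n : ℕ} (hn : 1 ≤ n) (i : ℕ) : (boundedSums n i).Finite :=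
  (Set.finite_Iic ((3 * n + 2) * i)).subset fun _ h => le_of_mem_boundedSums hn h

/-- Dropping one degree already decides whether a weight is new: s·i + x = s(i-1) + (x+s), and x + s
lies in the (i-1)-fold sumset as soon as it is at most (3n+2)(i-1). Dropping further only tightens
the bound, since s ≥ 3n+2. -/
theorem image_expWeight_sdiff {n r : ℕ} (hn : 2 ≤ n) (hr : 3 * n + 2 ≤ r) (i : ℕ) :
    expWeight (backelinExponents n r) '' {d | d.degree ≤ i} \
        expWeight (backelinExponents n r) '' {d | d.degree < i} =
      (fun x => backelinS n r * i + x) ''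
        (boundedSums n i \ {x | x + backelinS n r + (3 * n + 2) ≤ (3 * n + 2) * i}) := by
  ext v
  rw [Set.mem_sdiff, mem_image_expWeight_iff n r v (· ≤ i), mem_image_expWeight_iff n r v (· < i)]
  constructor
  · rintro ⟨⟨j, hj, x, hx, rfl⟩, hnot⟩
    obtain rfl : j = i := by
      by_contra hne
      exact hnot ⟨j, lt_of_le_of_ne hj hne, x, hx, rfl⟩
    refine ⟨x, ⟨hx, fun hle => hnot ?_⟩, rfl⟩
    rw [Set.mem_ofPred_eq] at hle
    obtain ⟨j, rfl⟩ : ∃ i, j = i + 1 := by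
      refine Nat.exists_eq_succ_of_ne_zero ?_
      rintro rfl
      omega
    refine ⟨j, Nat.lt_succ_self j, x + backelinS n r, ?_, by ring⟩
    have hle' : x + backelinS n r ≤ (3 * n + 2) * j := by linarith
    have hs : r * (3 * n + 2) + 3 = backelinS n r := rfl
    -- Since s > r(3n+2), the size bound puts `j` in the range where only the semigroup gaps matter.
    have hjr : r ≤ j := by
      by_contra hc
      nlinarith
    rw [mem_boundedSums_iff hn (by omega)]
    exact ⟨hle', Or.inr (by nlinarith)⟩
  · rintro ⟨x, ⟨hx, hnot⟩, rfl⟩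
    refine ⟨⟨i, le_rfl, x, hx, rfl⟩, ?_⟩
    rintro ⟨j, hj, y, hy, heq⟩
    apply hnot
    rw [Set.mem_ofPred_eq]
    have hy' := le_of_mem_boundedSums (by omega) hy
    obtain ⟨l, rfl⟩ := Nat.exists_eq_add_of_lt hj
    have : y = x + backelinS n r * (l + 1) := by
      have : backelinS n r * (j + l + 1) = backelinS n r * j + backelinS n r * (l + 1) := by ring
      simp only at heq
      omega
    nlinarith

/-- The number of values lost to shorter representations. -/
def correction (n r i : ℕ) : ℕ := if i < r + 2 then 0 else (3 * n + 2) * (i - (r + 2)) + n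

theorem ncard_boundedSums_inter {n r : ℕ} (hn : 2 ≤ n) (hr : 3 * n + 2 ≤ r) (i : ℕ) :
    (boundedSums n i ∩ {x | x + backelinS n r + (3 * n + 2) ≤ (3 * n + 2) * i}).ncard =
      correction n r i := by
  have hs : r * (3 * n + 2) + 3 = backelinS n r := rfl
  unfold correction
  split_ifs with hi
  · rw [Set.ncard_eq_zero ((finite_boundedSums (by omega) i).inter_of_left _), Set.eq_empty_iff_forall_notMem]
    rintro x ⟨-, hx⟩
    rw [Set.mem_ofPred_eq] at hx
    have : (3 * n + 2) * i ≤ (3 * n + 2) * (r + 1) := Nat.mul_le_mul_left _ (by omega)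
    nlinarith
  · obtain ⟨j, rfl⟩ := Nat.exists_eq_add_of_le (not_lt.mp hi)
    -- The bound becomes x < 3n + (3n+2)j. Below 3n only the n multiples of 3 occur; from 3n on
    -- there are no gaps.
    have hset : boundedSums n (r + 2 + j) ∩
        {x | x + backelinS n r + (3 * n + 2) ≤ (3 * n + 2) * (r + 2 + j)} =
        (((Finset.range n).image (3 * ·) ∪
          Finset.Ico (3 * n) (3 * n + (3 * n + 2) * j) : Finset ℕ) : Set ℕ) := by
      ext x
      have hiff : x + backelinS n r + (3 * n + 2) ≤ (3 * n + 2) * (r + 2 + j) ↔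
          x < 3 * n + (3 * n + 2) * j := by
        have : (3 * n + 2) * (r + 2 + j) + 1 + x =
          3 * n + (3 * n + 2) * j + x + backelinS n r + (3 * n + 2) := by rw [← hs]; ring
        omega
      rw [Set.mem_inter_iff, Set.mem_ofPred_eq, hiff, mem_boundedSums_iff hn (by omega)]
      simp only [Finset.coe_union, Finset.coe_image, Finset.coe_Ico, Set.mem_union, Set.mem_image,
        Finset.coe_range, Set.mem_Iio, Set.mem_Ico]
      constructor
      · rintro ⟨⟨-, h⟩, hlt⟩
        by_cases hx : x < 3 * n
        · exact Or.inl ⟨x / 3, by omega, by omega⟩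
        · exact Or.inr ⟨by omega, hlt⟩
      · rintro (⟨y, hy, rfl⟩ | ⟨hle, hlt⟩)
        · exact ⟨⟨by nlinarith, Or.inl ⟨y, rfl⟩⟩, by nlinarith⟩
        · refine ⟨⟨by nlinarith, ?_⟩, hlt⟩
          rcases hle.eq_or_lt with h | h
          · exact Or.inl ⟨n, h.symm⟩
          · exact Or.inr h
    rw [hset, Set.ncard_coe_finset, Finset.card_union_of_disjoint,
      Finset.card_image_of_injective _ (fun x y h => by simpa using h), Finset.card_range,
      Nat.card_Ico]
    · have : r + 2 + j - (r + 2) = j := by omega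
      rw [this]
      omega
    · rw [Finset.disjoint_left]
      intro x hx hx'
      simp only [Finset.mem_image, Finset.mem_range, Finset.mem_Ico] at hx hx'
      omega

theorem hilbertFunction_backelinIdeal_add (k : Type*) [Field k] {n r : ℕ} (hn : 2 ≤ n)
    (hr : 3 * n + 2 ≤ r) (i : ℕ) :
    hilbertFunction (backelinIdeal k n r) i + correction n r i = (boundedSums n i).ncard := by
  have h := hilbertFunction_monomialCurveIdeal (k := k) (backelinExponents n r) i
  rw [image_expWeight_sdiff hn hr, Set.ncard_image_of_injective _ (add_right_injective _)] at h
  change hilbertFunction (backelinIdeal k n r) i = _ at h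
  rw [h, ← ncard_boundedSums_inter hn hr, add_comm]
  exact Set.ncard_inter_add_ncard_sdiff_eq_ncard _ _ (finite_boundedSums (by omega) i)

/-! ### Counting normal triples by length -/

/-- The normal triples of length at most `i` with first entry zero, without that entry. -/
def zeroTriples (n i : ℕ) : Finset (ℕ × ℕ) :=
  (Finset.range (3 * n + 2) ×ˢ Finset.range (i + 1)).filter fun p => p.1 + p.2 ≤ i

/-- The normal triples with first entry at least one and at most `n`. -/
def smallTriples (n : ℕ) : Finset (ℕ × ℕ × ℕ) :=
  (Finset.Icc 1 n ×ˢ Finset.range 3 ×ˢ Finset.range (3 * n + 1)).filter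
    fun p => p.2.2 + 3 * p.1 ≤ 3 * n

theorem ncard_boundedSums_eq_ncard {n : ℕ} (hn : 2 ≤ n) (i : ℕ) :
    (boundedSums n i).ncard =
      {p : ℕ × ℕ × ℕ | IsNormalTriple n p.1 p.2.1 p.2.2 ∧ p.1 + p.2.1 + p.2.2 ≤ i}.ncard := by
  symm
  refine Set.ncard_congr (fun p _ => tripleValue n p.1 p.2.1 p.2.2) ?_ ?_ ?_
  · rintro ⟨a, b, c⟩ ⟨-, hle⟩
    exact ⟨a, b, c, hle, rfl⟩
  · rintro ⟨a, b, c⟩ ⟨a', b', c'⟩ ⟨h, -⟩ ⟨h', -⟩ hv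
    obtain ⟨rfl, rfl, rfl⟩ := eq_of_tripleValue_eq h h' hv
    rfl
  · rintro _ ⟨a, b, c, hle, rfl⟩
    obtain ⟨a', b', c', hv, hle', h⟩ := exists_isNormalTriple hn a b c
    exact ⟨(a', b', c'), ⟨h, hle'.trans hle⟩, hv⟩

theorem ncard_boundedSums {n : ℕ} (hn : 2 ≤ n) (i : ℕ) :
    (boundedSums n i).ncard = (zeroTriples n i).card +
      ((smallTriples n).filter fun p => p.1 + p.2.1 + p.2.2 ≤ i).card +
      ((Finset.Ioc n (2 * n)).filter (· ≤ i)).card := by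
  have hset : {p : ℕ × ℕ × ℕ | IsNormalTriple n p.1 p.2.1 p.2.2 ∧ p.1 + p.2.1 + p.2.2 ≤ i} =
      (((zeroTriples n i).image (fun p => (0, p)) ∪
        ((smallTriples n).filter fun p => p.1 + p.2.1 + p.2.2 ≤ i) ∪
        ((Finset.Ioc n (2 * n)).filter (· ≤ i)).image (fun a => (a, 0, 0)) :
          Finset (ℕ × ℕ × ℕ)) : Set (ℕ × ℕ × ℕ)) := by
    ext ⟨a, b, c⟩
    simp only [Set.mem_ofPred_eq, Finset.mem_coe, Finset.mem_union, Finset.mem_image,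
      Finset.mem_filter, zeroTriples, smallTriples, Finset.mem_product, Finset.mem_range,
      Finset.mem_Icc, Finset.mem_Ioc, IsNormalTriple, Prod.exists, Prod.mk.injEq]
    constructor
    · rintro ⟨h | h | h, hle⟩
      · exact Or.inl (Or.inl ⟨b, c, by omega, by omega, rfl, rfl⟩)
      · exact Or.inl (Or.inr (by omega))
      · exact Or.inr ⟨a, by omega, by omega⟩
    · rintro ((⟨b', c', h, h1, rfl, rfl⟩ | h) | ⟨a', h, h'⟩)
      · omega
      · omega
      · omega
  rw [ncard_boundedSums_eq_ncard hn, hset, Set.ncard_coe_finset, Finset.card_union_of_disjoint,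
    Finset.card_union_of_disjoint, Finset.card_image_of_injective,
    Finset.card_image_of_injective]
  · exact fun a b h => by simpa using h
  · exact fun a b h => by simpa using h
  · rw [Finset.disjoint_left]
    rintro ⟨a, b, c⟩ h h'
    simp only [Finset.mem_image, Finset.mem_filter, smallTriples, Finset.mem_product,
      Finset.mem_Icc, Prod.mk.injEq] at h h'
    obtain ⟨_, _, h, _⟩ := h
    omega
  · rw [Finset.disjoint_left]
    rintro ⟨a, b, c⟩ h h'
    simp only [Finset.mem_union, Finset.mem_image, Finset.mem_filter, smallTriples,
      Finset.mem_product, Finset.mem_Icc, Finset.mem_Ioc, Prod.mk.injEq] at h h'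
    obtain ⟨_, h', _⟩ := h'
    rcases h with ⟨_, _, h, _⟩ | h
    · omega
    · omega

/-! ### Generating series -/

open PowerSeries

theorem card_zeroTriples (n i : ℕ) :
    (zeroTriples n i).card = ∑ b ∈ Finset.range (3 * n + 2), (i + 1 - b) := by
  rw [Finset.card_eq_sum_ones, Finset.sum_finset_product _ (Finset.range (3 * n + 2))
    (fun b => Finset.range (i + 1 - b))]
  · simp
  · rintro ⟨b, c⟩
    simp only [zeroTriples, Finset.mem_filter, Finset.mem_product, Finset.mem_range]
    omega

theorem mk_succ_mul_one_sub_sq :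
    (mk fun i => ((i + 1 : ℕ) : ℤ)) * (1 - X) ^ 2 = 1 := by
  have h : (mk fun i => ((i + 1 : ℕ) : ℤ)) * (1 - X) = mk 1 := by
    ext i
    rw [mul_sub, mul_one, map_sub]
    cases i with
    | zero => simp
    | succ i => rw [coeff_succ_mul_X]; simp
  rw [sq, ← mul_assoc, h, mk_one_mul_one_sub_eq_one]

theorem mk_sub_mul_one_sub_sq (b : ℕ) :
    (mk fun i => ((i + 1 - b : ℕ) : ℤ)) * (1 - X) ^ 2 = X ^ b := by
  have h : (mk fun i => ((i + 1 - b : ℕ) : ℤ)) = X ^ b * mk fun i => ((i + 1 : ℕ) : ℤ) := by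
    ext i
    rw [coeff_X_pow_mul', coeff_mk]
    split_ifs with hb
    · rw [coeff_mk, show i + 1 - b = i - b + 1 by omega]
    · rw [show i + 1 - b = 0 by omega, Nat.cast_zero]
  rw [h, mul_assoc, mk_succ_mul_one_sub_sq, mul_one]

theorem series_finset_sum {ι : Type*} (s : Finset ι) (f : ι → ℕ → ℕ) :
    series (fun i => ∑ b ∈ s, f b i) = ∑ b ∈ s, series (f b) := by
  ext i
  simp [series]

theorem series_add (f g : ℕ → ℕ) : series (fun i => f i + g i) = series f + series g := by
  ext i
  simp [series]

theorem series_zeroTriples (n : ℕ) :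
    series (fun i => (zeroTriples n i).card) * (1 - X) ^ 3 = 1 - X ^ (3 * n + 2) := by
  have h : series (fun i => (zeroTriples n i).card) * (1 - X) ^ 2 =
      ∑ b ∈ Finset.range (3 * n + 2), X ^ b := by
    simp_rw [card_zeroTriples, series_finset_sum, Finset.sum_mul]
    exact Finset.sum_congr rfl fun b _ => mk_sub_mul_one_sub_sq b
  rw [pow_succ, ← mul_assoc, h, geom_sum_mul_neg]

theorem series_card_filter_le {ι : Type*} (s : Finset ι) (l : ι → ℕ) :
    series (fun i => (s.filter fun p => l p ≤ i).card) * (1 - X) = ∑ p ∈ s, X ^ l p := by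
  have h : series (fun i => (s.filter fun p => l p ≤ i).card) =
      (∑ p ∈ s, X ^ l p) * mk 1 := by
    ext i
    simp [series, Finset.sum_mul, coeff_X_pow_mul']
  rw [h, mul_assoc, mk_one_mul_one_sub_eq_one, mul_one]

theorem sum_smallTriples (n : ℕ) :
    ∑ p ∈ smallTriples n, (X : ℤ⟦X⟧) ^ (p.1 + p.2.1 + p.2.2) =
      (∑ a ∈ Finset.Icc 1 n, X ^ a * ∑ c ∈ Finset.range (3 * n - 3 * a + 1), X ^ c) *
        (1 + X + X ^ 2) := by
  rw [Finset.sum_finset_product _ (Finset.Icc 1 n)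
    (fun a => Finset.range 3 ×ˢ Finset.range (3 * n - 3 * a + 1))]
  · rw [Finset.sum_mul]
    refine Finset.sum_congr rfl fun a _ => ?_
    rw [Finset.sum_product]
    simp only [Finset.sum_range_succ _ 2, Finset.sum_range_succ _ 1, Finset.sum_range_succ _ 0,
      Finset.range_zero, Finset.sum_empty, pow_add, ← Finset.mul_sum]
    ring
  · rintro ⟨a, b, c⟩
    simp only [smallTriples, Finset.mem_filter, Finset.mem_product, Finset.mem_range,
      Finset.mem_Icc]
    omega

/-- The sum `∑ t ^ (n + 2 i - 1)` over `1 ≤ i ≤ n`. -/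
noncomputable def oddSum (n : ℕ) : ℤ⟦X⟧ := ∑ i ∈ Finset.range n, X ^ (n + 2 * i + 1)

theorem oddSum_mul (n : ℕ) : oddSum n * (1 - X ^ 2) = X ^ (n + 1) - X ^ (3 * n + 1) := by
  have h : oddSum n = X ^ (n + 1) * ∑ i ∈ Finset.range n, (X ^ 2) ^ i := by
    rw [oddSum, Finset.mul_sum]
    exact Finset.sum_congr rfl fun i _ => by ring
  rw [h, mul_assoc, geom_sum_mul_neg]
  ring

theorem sum_smallTriples_mul (n : ℕ) :
    (∑ p ∈ smallTriples n, (X : ℤ⟦X⟧) ^ (p.1 + p.2.1 + p.2.2)) * (1 - X) ^ 3 =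
      (X - X ^ (n + 1)) * (1 - X ^ 3) - oddSum n * (1 - X) * (1 - X ^ 3) := by
  have h : (∑ a ∈ Finset.Icc 1 n, (X : ℤ⟦X⟧) ^ a * ∑ c ∈ Finset.range (3 * n - 3 * a + 1), X ^ c) *
      (1 - X) = ∑ a ∈ Finset.range n, X ^ (a + 1) - oddSum n := by
    -- The inner geometric sum ends in the exponent a + (3n - 3a + 1) = 3n - 2a + 1, which runs
    -- through the exponents of `oddSum` backwards.
    rw [oddSum, ← Finset.sum_range_reflect (fun i => (X : ℤ⟦X⟧) ^ (n + 2 * i + 1)),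
      ← Finset.sum_sub_distrib, Finset.sum_mul]
    refine (Finset.sum_nbij (fun i => i + 1) ?_ ?_ ?_ ?_).symm
    · intro i hi
      rw [Finset.mem_range] at hi
      rw [Finset.mem_Icc]
      omega
    · exact fun i _ j _ h => by simpa using h
    · intro a ha
      rw [Finset.mem_coe, Finset.mem_Icc] at ha
      exact ⟨a - 1, by rw [Finset.mem_coe, Finset.mem_range]; omega, by simp only; omega⟩
    · intro i hi
      rw [Finset.mem_range] at hi
      rw [mul_assoc, geom_sum_mul_neg, mul_sub, mul_one, ← pow_add]
      congr 2
      omega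
  have h' : (∑ a ∈ Finset.range n, (X : ℤ⟦X⟧) ^ (a + 1)) * (1 - X) = X - X ^ (n + 1) := by
    simp_rw [pow_succ, ← Finset.sum_mul]
    rw [mul_right_comm, geom_sum_mul_neg]
    ring
  rw [sum_smallTriples]
  linear_combination (1 - X) ^ 2 * (1 + X + X ^ 2) * h + (1 - X ^ 3) * h'

theorem sum_Ioc_mul (n : ℕ) :
    (∑ a ∈ Finset.Ioc n (2 * n), (X : ℤ⟦X⟧) ^ a) * (1 - X) = X ^ (n + 1) - X ^ (2 * n + 1) := by
  have h : ∑ a ∈ Finset.Ioc n (2 * n), (X : ℤ⟦X⟧) ^ a =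
      X ^ (n + 1) * ∑ i ∈ Finset.range n, X ^ i := by
    rw [Finset.mul_sum]
    refine (Finset.sum_nbij (fun i => n + 1 + i) ?_ ?_ ?_ ?_).symm
    · intro i hi
      rw [Finset.mem_range] at hi
      rw [Finset.mem_Ioc]
      omega
    · exact fun i _ j _ h => by simpa using h
    · intro a ha
      rw [Finset.mem_coe, Finset.mem_Ioc] at ha
      exact ⟨a - (n + 1), by rw [Finset.mem_coe, Finset.mem_range]; omega, by simp only; omega⟩
    · exact fun i _ => (pow_add _ _ _).symm
  rw [h, mul_assoc, geom_sum_mul_neg]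
  ring

theorem series_boundedSums {n : ℕ} (hn : 2 ≤ n) :
    series (fun i => (boundedSums n i).ncard) * (1 - X) ^ 4 =
      1 - X ^ (2 * n + 1) * (1 - X) ^ 2 + X ^ (n + 4) + X ^ (n + 3) - X ^ (n + 2) - X ^ (n + 1)
        - X ^ 4 - (oddSum n - X ^ (n + 1)) * (1 - X) ^ 2 := by
  simp_rw [ncard_boundedSums hn, series_add]
  have h1 := series_zeroTriples n
  have h2 := series_card_filter_le (smallTriples n) fun p => p.1 + p.2.1 + p.2.2
  have h3 := series_card_filter_le (Finset.Ioc n (2 * n)) fun p => p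
  have h4 := sum_smallTriples_mul n
  have h5 := sum_Ioc_mul n
  have h6 := oddSum_mul n
  -- By 1 - X^3 = (1 - X) + X(1 - X^2), `h6` turns part of the `oddSum` term into powers of X,
  -- cancelling X^(3n+2) from `h1`.
  linear_combination (1 - X) * h1 + (1 - X) ^ 3 * h2 + (1 - X) ^ 3 * h3 + h4
    + (1 - X) ^ 2 * h5 - X * (1 - X) * h6

theorem series_correction (n r : ℕ) :
    series (correction n r) * (1 - X) ^ 4 =
      X ^ (r + 2) * ((n : ℤ⟦X⟧) + (2 * (n : ℤ⟦X⟧) + 2) * X) * (1 - X) ^ 2 := by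
  -- With j = i - (r+2), this is (3n+2)j + n = (3n+2)(j+1) - (2n+2).
  have h : series (correction n r) = X ^ (r + 2) *
      (((3 * n + 2 : ℕ) : ℤ⟦X⟧) * (mk fun i => ((i + 1 : ℕ) : ℤ)) - ((2 * n + 2 : ℕ) : ℤ⟦X⟧) * mk 1) := by
    ext i
    rw [series, coeff_mk, coeff_X_pow_mul', correction]
    by_cases hi : i < r + 2
    · rw [if_pos hi, if_neg (by omega), Nat.cast_zero]
    · rw [if_neg hi, if_pos (by omega), map_sub, ← map_natCast (C (R := ℤ)),
        ← map_natCast (C (R := ℤ)), coeff_C_mul, coeff_C_mul, coeff_mk, coeff_mk]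
      push_cast
      simp only [Pi.one_apply]
      ring
  have h1 := mk_succ_mul_one_sub_sq
  have h2 := mk_one_mul_one_sub_eq_one (S := ℤ)
  rw [h]
  push_cast at h1 ⊢
  linear_combination X ^ (r + 2) * (1 - X) ^ 2 * (3 * n + 2) * h1
    - X ^ (r + 2) * (1 - X) ^ 3 * (2 * n + 2) * h2

theorem coe_backelinNumerator {n : ℕ} (hn : 2 ≤ n) (r : ℕ) :
    (backelinNumerator n r : ℤ⟦X⟧) =
      1 - X ^ (2 * n + 1) * (1 - X) ^ 2 + X ^ (n + 4) + X ^ (n + 3) - X ^ (n + 2) - X ^ (n + 1)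
        - X ^ 4 - (oddSum n - X ^ (n + 1)) * (1 - X) ^ 2
        - X ^ (r + 2) * ((n : ℤ⟦X⟧) + (2 * (n : ℤ⟦X⟧) + 2) * X) * (1 - X) ^ 2 := by
  have hsum : (∑ i ∈ Finset.Icc 2 n, ((X : ℤ⟦X⟧) ^ (n + 2 * i - 1) + X ^ (n + 2 * i + 1)
      - 2 * X ^ (n + 2 * i))) = (oddSum n - X ^ (n + 1)) * (1 - X) ^ 2 := by
    -- Exposing n as a successor splits off the first term X^(n+1) of `oddSum`, which the sum from 2
    -- to n omits; each summand is X^(n+2i-1)(1-X)^2.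
    obtain ⟨l, rfl⟩ := Nat.exists_eq_add_of_le' (show 1 ≤ n by omega)
    rw [oddSum, Finset.sum_range_succ']
    simp only [mul_zero, add_zero, add_sub_cancel_right]
    rw [Finset.sum_mul]
    refine (Finset.sum_nbij (fun i => i + 2) ?_ ?_ ?_ ?_).symm
    · intro i hi
      rw [Finset.mem_range] at hi
      rw [Finset.mem_Icc]
      omega
    · exact fun i _ j _ h => by simpa using h
    · intro a ha
      rw [Finset.mem_coe, Finset.mem_Icc] at ha
      exact ⟨a - 2, by rw [Finset.mem_coe, Finset.mem_range]; omega, by simp only; omega⟩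
    · intro i _
      rw [show l + 1 + 2 * (i + 2) - 1 = l + 1 + 2 * (i + 1) + 1 by omega]
      ring
  have hcoe : (backelinNumerator n r : ℤ⟦X⟧) =
      1 - (n : ℤ⟦X⟧) * X ^ (r + 2) - 2 * X ^ (r + 3) + (3 * (n : ℤ⟦X⟧) + 4) * X ^ (r + 4)
        - (2 * (n : ℤ⟦X⟧) + 2) * X ^ (r + 5)
        - X ^ (2 * n + 3) + 2 * X ^ (2 * n + 2) - X ^ (2 * n + 1)
        + X ^ (n + 4) + X ^ (n + 3) - X ^ (n + 2) - X ^ (n + 1) - X ^ 4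
        - ∑ i ∈ Finset.Icc 2 n,
            (X ^ (n + 2 * i - 1) + X ^ (n + 2 * i + 1) - 2 * X ^ (n + 2 * i)) := by
    rw [backelinNumerator, ← Polynomial.coeToPowerSeries.ringHom_apply]
    simp only [map_sub, map_add, map_mul, map_pow, map_sum, map_one, map_natCast, map_ofNat,
      Polynomial.coeToPowerSeries.ringHom_apply, Polynomial.coe_X]
  rw [hcoe, hsum]
  ring

theorem series_hilbertFunction_backelinIdeal (k : Type*) [Field k] {n r : ℕ} (hn : 2 ≤ n)
    (hr : 3 * n + 2 ≤ r) :
    series (hilbertFunction (backelinIdeal k n r)) * (1 - X) ^ 4 =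
      (backelinNumerator n r : ℤ⟦X⟧) := by
  have h : series (hilbertFunction (backelinIdeal k n r)) + series (correction n r) =
      series (fun i => (boundedSums n i).ncard) := by
    rw [← series_add]
    exact congrArg series (funext (hilbertFunction_backelinIdeal_add k hn hr))
  rw [coe_backelinNumerator hn, ← series_boundedSums hn, ← series_correction]
  linear_combination (1 - X) ^ 4 * h

end BackelinCurve

theorem mainTheorem7 (k : Type*) [Field k] (n r : ℕ) (hn : 2 ≤ n) (hr : 3 * n + 2 ≤ r) :
    BackelinCurve.series
        (BackelinCurve.hilbertFunction (BackelinCurve.backelinIdeal k n r)) *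
        (1 - PowerSeries.X) ^ 4 =
      (BackelinCurve.backelinNumerator n r : PowerSeries ℤ) ∧
    BackelinCurve.series
        (BackelinCurve.gradedHilbertFunction
          (BackelinCurve.initialIdeal (BackelinCurve.backelinIdeal k n r))) *
        (1 - PowerSeries.X) ^ 4 =
      (BackelinCurve.backelinNumerator n r : PowerSeries ℤ) := by
  have h := BackelinCurve.series_hilbertFunction_backelinIdeal k hn hr
  refine ⟨h, ?_⟩
  rw [← h]
  exact congrArg (fun f => BackelinCurve.series f * (1 - PowerSeries.X) ^ 4)
    (funext (BackelinCurve.gradedHilbertFunction_initialIdeal _))
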